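/- Let $1\le q\le p$ be integers, $\rho\in[0,1)$, and let $P^+(q)$ be the set of real symmetric positive definite $q\times q$ matrices. Write $A\circ B=B^{1/2}AB^{1/2}$ for $A,B\in P^+(q)$, with the positive definite square root. Let $U\in P^+(p)$ and let $x$ be a real $p\times q$ matrix with $\det(x^\top U^{-1}x)\neq 0$. The MpCN proposal from $x$ is $$y=\rho^{1/2}x+(1-\rho)^{1/2}w,\qquad w\mid V\sim N_{p,q}(0,U,V),\qquad V\sim W_q^{-1}(p,\,x^\top U^{-1}x),$$ where $N_{p,q}(0,U,V)$ is the matrix-normal law (row covariance $U$, column covariance $V$) and $W_q^{-1}(p,T)$ is the inverse-Wishart law, i.e. the law of $(X^\top X)^{-1}$ for $X\sim N_{p,q}(0,I_p,T^{-1})$. Let $\mathcal L$ be the law of the random matrix $\epsilon$ defined by $y^\top U^{-1}y=\epsilon\circ(x^\top U^{-1}x)$ (this law in fact does not depend on $x$ or $U$). Let $\tilde\pi:P^+(q)\to(0,\infty)$ be continuous; it plays the role of the density, not necessarily normalised, of the target $\tilde\Pi(dS)=\tilde\pi(S)\,\mu(dS)$ with respect to $\mu(dS)=(\det S)^{-(q+1)/2}\prod_{i\le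 j}dS_{ij}$. The MpCN kernel on $P^+(q)$ is the Metropolis kernel $$\tilde P(S,A)=\int_A \tilde Q(S,dS')\,a(S,S')+\Big(1-\int \tilde Q(S,dS')\,a(S,S')\Big)\delta_S(A),\qquad a(S,S')=\min\{1,\tilde\pi(S')/\tilde\pi(S)\},$$ where $\tilde Q(S,\cdot)$ is the law of $\epsilon\circ S$ for $\epsilon\sim\mathcal L$. Suppose that for some $\zeta\neq 0$ and every $\epsilon\in P^+(q)$, $$\frac{\tilde\pi(\epsilon\circ S)}{\tilde\pi(S)}\longrightarrow \det(\epsilon)^{\zeta/2}\qquad\text{as } \operatorname{tr}(S)\to 0,\ S\in P^+(q).$$ Then for every $\alpha\in(0,1)$ the function $\mathsf V(S)=\tilde\pi(S)^{-\alpha}$ is $\tilde P(S,\cdot)$-integrable for every $S\in P^+(q)$, and $$\limsup_{\operatorname{tr}(S)\to 0}\frac{\tilde P\mathsf V(S)-\mathsf V(S)}{\mathsf V(S)}<0 .$$ -/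

import Mathlib

open MeasureTheory Filter Topology
open scoped MatrixOrder ENNReal

namespace MpCN

/-- Matrices carry the product (equivalently, Borel) sigma-algebra of their entries. -/
instance instMeasurableSpaceMatrix {m n : ℕ} :
    MeasurableSpace (Matrix (Fin m) (Fin n) ℝ) :=
  inferInstanceAs (MeasurableSpace (Fin m → Fin n → ℝ))

instance instBorelSpaceMatrix {m n : ℕ} : BorelSpace (Matrix (Fin m) (Fin n) ℝ) :=
  inferInstanceAs (BorelSpace (Fin m → Fin n → ℝ))

/-- The law of a `p × q` matrix with independent standard normal entries. -/
noncomputable def stdNormal (p q : ℕ) : Measure (Matrix (Fin p) (Fin q) ℝ) :=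
  Measure.pi (fun _ : Fin p => Measure.pi (fun _ : Fin q => ProbabilityTheory.gaussianReal 0 1))

/-- The matrix `M + Σ^{1/2} Z T^{1/2}`; its law is the Matrix-Normal law `N_{p,q}(M, Σ, T)`
when `Z` has independent standard normal entries. Here `CFC.sqrt` is the positive semidefinite
square root. -/
noncomputable def affineNormal {p q : ℕ} (M : Matrix (Fin p) (Fin q) ℝ)
    (Sig : Matrix (Fin p) (Fin p) ℝ) (T : Matrix (Fin q) (Fin q) ℝ)
    (Z : Matrix (Fin p) (Fin q) ℝ) : Matrix (Fin p) (Fin q) ℝ :=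
  M + CFC.sqrt Sig * Z * CFC.sqrt T

/-- The Matrix-Normal law `N_{p,q}(M, Σ, T)`. -/
noncomputable def matrixNormal {p q : ℕ} (M : Matrix (Fin p) (Fin q) ℝ)
    (Sig : Matrix (Fin p) (Fin p) ℝ) (T : Matrix (Fin q) (Fin q) ℝ) :
    Measure (Matrix (Fin p) (Fin q) ℝ) :=
  (stdNormal p q).map (affineNormal M Sig T)

/-- The Wishart law `W_q(r, T)` with `r` degrees of freedom: the law of `Xᵀ X` for
`X ∼ N_{r,q}(0, I_r, T)`. -/
noncomputable def wishart {q : ℕ} (r : ℕ) (T : Matrix (Fin q) (Fin q) ℝ) :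
    Measure (Matrix (Fin q) (Fin q) ℝ) :=
  (matrixNormal (0 : Matrix (Fin r) (Fin q) ℝ) 1 T).map (fun X => X.transpose * X)

/-- The Inverse-Wishart law `W_q⁻¹(r, T)`: the law of `S⁻¹` for `S ∼ W_q(r, T⁻¹)`. -/
noncomputable def invWishart {q : ℕ} (r : ℕ) (T : Matrix (Fin q) (Fin q) ℝ) :
    Measure (Matrix (Fin q) (Fin q) ℝ) :=
  (wishart r T⁻¹).map (fun S => S⁻¹)

/-- The quadratic map `x ↦ xᵀ U⁻¹ x` from `p × q` matrices to `q × q` matrices. -/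
noncomputable def gram {p q : ℕ} (U : Matrix (Fin p) (Fin p) ℝ)
    (x : Matrix (Fin p) (Fin q) ℝ) : Matrix (Fin q) (Fin q) ℝ :=
  x.transpose * U⁻¹ * x

/-- The MpCN proposal `Q(x, dy)` on `p × q` matrices: the law of
`y = ρ^{1/2} x + (1 - ρ)^{1/2} w`, where `V ∼ W_q⁻¹(p, xᵀ U⁻¹ x)` and, given `V`,
`w ∼ N_{p,q}(0, U, V)`, realised as `w = U^{1/2} Z V^{1/2}` with `Z` standard normal and
independent of `V`. -/
noncomputable def mpcnProposal {p q : ℕ} (ρ : ℝ) (U : Matrix (Fin p) (Fin p) ℝ)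
    (x : Matrix (Fin p) (Fin q) ℝ) : Measure (Matrix (Fin p) (Fin q) ℝ) :=
  ((invWishart p (gram U x)).prod (stdNormal p q)).map
    (fun VZ => Real.sqrt ρ • x + Real.sqrt (1 - ρ) • affineNormal 0 U VZ.1 VZ.2)

/-- The operation `A ∘ B = B^{1/2} A B^{1/2}`. -/
noncomputable def circ {q : ℕ} (A B : Matrix (Fin q) (Fin q) ℝ) :
    Matrix (Fin q) (Fin q) ℝ :=
  CFC.sqrt B * A * CFC.sqrt B

/-- The law of the random matrix `ε` with `yᵀ U⁻¹ y = ε ∘ (xᵀ U⁻¹ x)`, that is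
`ε = (yᵀ U⁻¹ y) ∘ (xᵀ U⁻¹ x)⁻¹`, where `y ∼ Q(x, dy)` is the MpCN proposal from `x`. -/
noncomputable def mpcnNoise {p q : ℕ} (ρ : ℝ) (U : Matrix (Fin p) (Fin p) ℝ)
    (x : Matrix (Fin p) (Fin q) ℝ) : Measure (Matrix (Fin q) (Fin q) ℝ) :=
  (mpcnProposal ρ U x).map (fun y => circ (gram U y) (gram U x)⁻¹)

/-- The random-walk proposal `Q̃(S, ·)`: the law of `ε ∘ S` for `ε ∼ L`. -/
noncomputable def walkProposal {q : ℕ} (L : Measure (Matrix (Fin q) (Fin q) ℝ))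
    (S : Matrix (Fin q) (Fin q) ℝ) : Measure (Matrix (Fin q) (Fin q) ℝ) :=
  L.map (fun e => circ e S)

/-- The Metropolis acceptance probability `min {1, π(S') / π(S)}`. -/
noncomputable def acceptance {X : Type*} (dens : X → ℝ) (S S' : X) : ℝ :=
  min 1 (dens S' / dens S)

/-- The Metropolis--Hastings kernel
`P(S, A) = ∫_A Q(S, dS') α(S, S') + (1 - ∫ Q(S, dS') α(S, S')) δ_S(A)`. -/
noncomputable def metropolis {X : Type*} [MeasurableSpace X] (dens : X → ℝ)
    (Q : X → Measure X) (S : X) : Measure X :=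
  (Q S).withDensity (fun S' => ENNReal.ofReal (acceptance dens S S')) +
    (1 - ∫⁻ S', ENNReal.ofReal (acceptance dens S S') ∂(Q S)) • Measure.dirac S

/-- The MpCN kernel `P̃(S, ·)` on positive definite `q × q` matrices, with target density `dens`:
the Metropolis kernel for the proposal `ε ∘ S`, the law of `ε` being read off from the MpCN
proposal at the reference pair `(U, x)`. -/
noncomputable def mpcnKernel {p q : ℕ} (ρ : ℝ) (U : Matrix (Fin p) (Fin p) ℝ)
    (x : Matrix (Fin p) (Fin q) ℝ) (dens : Matrix (Fin q) (Fin q) ℝ → ℝ) :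
    Matrix (Fin q) (Fin q) ℝ → Measure (Matrix (Fin q) (Fin q) ℝ) :=
  metropolis dens (walkProposal (mpcnNoise ρ U x))

/-- The filter of positive definite matrices `S` with `tr S → 0`. -/
def traceToZero (q : ℕ) : Filter (Matrix (Fin q) (Fin q) ℝ) :=
  comap Matrix.trace (𝓝 0) ⊓ 𝓟 {S | S.PosDef}

end MpCN

namespace MpCN
open ProbabilityTheory Matrix

/-! A rejected move does not change `V`, so the relative drift at `S` is the integral over the noise
`ε` of `drift α r = min 1 r * (r ^ (-α) - 1)` with `r = dens (ε ∘ S) / dens S`. Since `0 < α < 1`,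
`|drift α r| ≤ 1` for `r > 0`. Dominated convergence therefore gives, as the trace tends to 0, the
limit `∫ drift α (det ε ^ (ζ/2))`, and it remains to see that this is negative.

For `r > 1`, `drift α r + drift α r⁻¹ = -(1 - r ^ (-α)) (1 - r ^ (α - 1)) < 0`. So it suffices that
`det ε` and its inverse have the same law and that `det ε ≠ 1` almost surely. Only the determinant
of the noise matters, not its full law.

With `a = √ρ`, `b = √(1 - ρ)` and independent standard normal `G`, `Z`, orthogonal invariance shows
that `det ε` is distributed as the ratio of the Gram determinants of `a G + b Z` and `G`
(`map_det_mpcnNoise`). The reflection `(G, Z) ↦ (a G + b Z, b G - a Z)` preserves the Gaussian law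
and inverts this ratio (`detRatio_reflect`). The ratio is almost surely not 1 because level sets of
a Gram determinant are Lebesgue null (`ae_det_gram_ne`). -/

instance instPolishSpaceMatrix {m n : ℕ} : PolishSpace (Matrix (Fin m) (Fin n) ℝ) :=
  inferInstanceAs (PolishSpace (Fin m → Fin n → ℝ))

instance instIsProbabilityMeasureStdNormal (p q : ℕ) : IsProbabilityMeasure (stdNormal p q) :=
  inferInstanceAs (IsProbabilityMeasure (Measure.pi (fun _ : Fin p =>
    Measure.pi (fun _ : Fin q => gaussianReal 0 1))))

/-! ### Invariance of the standard normal law -/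

lemma charFunDual_gaussianReal_std (L : StrongDual ℝ ℝ) :
    charFunDual (gaussianReal 0 1) L = Complex.exp (-(((L 1) ^ 2 : ℝ) : ℂ) / 2) := by
  have h : (L : ℝ → ℝ) = fun x => L 1 * x := by
    ext x
    have := L.map_smul x 1
    simpa [mul_comm] using this
  rw [charFunDual_eq_charFun_map_one, h, gaussianReal_map_const_mul, charFun_gaussianReal]
  simp [neg_div]

/-- The standard normal law, on functions of two indices instead of matrices. -/
noncomputable def stdNormalFun (p q : ℕ) : Measure (Fin p → Fin q → ℝ) :=
  Measure.pi (fun _ : Fin p => Measure.pi (fun _ : Fin q => gaussianReal 0 1))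

instance (p q : ℕ) : IsProbabilityMeasure (stdNormalFun p q) := by
  unfold stdNormalFun; infer_instance

lemma charFunDual_stdNormalFun {p q : ℕ} (L : StrongDual ℝ (Fin p → Fin q → ℝ)) :
    charFunDual (stdNormalFun p q) L =
      Complex.exp (-((∑ i, ∑ j, L (Pi.single i (Pi.single j 1)) ^ 2 : ℝ) : ℂ) / 2) := by
  rw [stdNormalFun, charFunDual_pi]
  simp_rw [charFunDual_pi, charFunDual_gaussianReal_std, ← Complex.exp_sum]
  congr 1
  push_cast
  simp [Finset.sum_div, neg_div]

/-- The characteristic functional depends on `L` only through the squared length of its coefficient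
vector, so a linear map whose transpose preserves that length preserves the law. -/
lemma map_stdNormalFun {p q : ℕ} (f : (Fin p → Fin q → ℝ) →L[ℝ] (Fin p → Fin q → ℝ))
    (hf : ∀ L : StrongDual ℝ (Fin p → Fin q → ℝ),
      ∑ i, ∑ j, L (f (Pi.single i (Pi.single j 1))) ^ 2 =
        ∑ i, ∑ j, L (Pi.single i (Pi.single j 1)) ^ 2) :
    (stdNormalFun p q).map f = stdNormalFun p q := by
  have : IsProbabilityMeasure ((stdNormalFun p q).map f) :=
    Measure.isProbabilityMeasure_map (by fun_prop)
  apply Measure.ext_of_charFunDual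
  ext L
  rw [charFunDual_map, charFunDual_stdNormalFun, charFunDual_stdNormalFun, ← hf L]
  rfl

lemma sum_sq_mulVec_of_orthogonal {m : ℕ} {R : Matrix (Fin m) (Fin m) ℝ} (hR : R * Rᵀ = 1)
    (v : Fin m → ℝ) : ∑ i, (∑ k, R k i * v k) ^ 2 = ∑ k, v k ^ 2 := by
  have h1 : ∑ i, (∑ k, R k i * v k) ^ 2 = (Rᵀ *ᵥ v) ⬝ᵥ (Rᵀ *ᵥ v) := by
    simp [dotProduct, mulVec, sq]
  rw [h1, dotProduct_mulVec, vecMul_transpose, mulVec_mulVec, hR, one_mulVec]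
  simp [dotProduct, sq]

/-- Left multiplication, on functions of two indices. -/
noncomputable def leftMulCLM {p : ℕ} (q : ℕ) (R : Matrix (Fin p) (Fin p) ℝ) :
    (Fin p → Fin q → ℝ) →L[ℝ] (Fin p → Fin q → ℝ) :=
  ContinuousLinearMap.pi fun i => ∑ k, R i k • ContinuousLinearMap.proj k

/-- Right multiplication, on functions of two indices. -/
noncomputable def rightMulCLM (p : ℕ) {q : ℕ} (O : Matrix (Fin q) (Fin q) ℝ) :
    (Fin p → Fin q → ℝ) →L[ℝ] (Fin p → Fin q → ℝ) :=
  ContinuousLinearMap.pi fun i => ContinuousLinearMap.pi fun j =>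
    ∑ k, O k j • ((ContinuousLinearMap.proj k : (Fin q → ℝ) →L[ℝ] ℝ) ∘L
      (ContinuousLinearMap.proj i : (Fin p → Fin q → ℝ) →L[ℝ] (Fin q → ℝ)))

lemma measurePreserving_leftMul {p : ℕ} (q : ℕ) {R : Matrix (Fin p) (Fin p) ℝ}
    (hR : Rᵀ * R = 1) :
    MeasurePreserving (fun Z => R * Z) (stdNormal p q) (stdNormal p q) := by
  have hR' : R * Rᵀ = 1 := mul_eq_one_comm.1 hR
  have h := map_stdNormalFun (leftMulCLM q R) (fun L => by
    -- With the column index held fixed, the coefficients of `L` along that column are transformed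
    -- by `Rᵀ`.
    rw [Finset.sum_comm]
    conv_rhs => rw [Finset.sum_comm]
    refine Finset.sum_congr rfl fun j _ => ?_
    refine (Finset.sum_congr rfl fun i _ => ?_).trans
      (sum_sq_mulVec_of_orthogonal hR' fun k => L (Pi.single k (Pi.single j 1)))
    congr 1
    have : leftMulCLM q R (Pi.single i (Pi.single j 1)) =
        ∑ k, R k i • (Pi.single k (Pi.single j 1) : Fin p → Fin q → ℝ) := by
      ext a b
      by_cases hb : b = j <;>
        simp [leftMulCLM, Pi.single_apply, Finset.sum_apply, ite_apply, hb]
    rw [this, map_sum]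
    simp)
  have heq : (leftMulCLM q R : (Fin p → Fin q → ℝ) → _) =
      fun Z : Matrix (Fin p) (Fin q) ℝ => R * Z := by
    ext Z i j
    refine Eq.trans ?_ (Matrix.mul_apply (M := R) (N := Matrix.of Z)).symm
    simp [leftMulCLM]
  refine ⟨Continuous.measurable (by fun_prop), ?_⟩
  rw [heq] at h
  exact h

lemma measurePreserving_rightMul (p : ℕ) {q : ℕ} {O : Matrix (Fin q) (Fin q) ℝ}
    (hO : O * Oᵀ = 1) :
    MeasurePreserving (fun Z => Z * O) (stdNormal p q) (stdNormal p q) := by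
  have hO' : Oᵀ * Oᵀᵀ = 1 := by rw [transpose_transpose]; exact mul_eq_one_comm.1 hO
  have h := map_stdNormalFun (rightMulCLM p O) (fun L => by
    refine Finset.sum_congr rfl fun i _ => ?_
    refine (Finset.sum_congr rfl fun j _ => ?_).trans
      (sum_sq_mulVec_of_orthogonal hO' fun k => L (Pi.single i (Pi.single k 1)))
    congr 1
    have : rightMulCLM p O (Pi.single i (Pi.single j 1)) =
        ∑ k, O j k • (Pi.single i (Pi.single k 1) : Fin p → Fin q → ℝ) := by
      ext a b
      by_cases ha : a = i
      · subst ha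
        simp [rightMulCLM, Pi.single_apply, Finset.sum_apply]
      · simp [rightMulCLM, Finset.sum_apply, ha]
    rw [this, map_sum]
    simp)
  have heq : (rightMulCLM p O : (Fin p → Fin q → ℝ) → _) =
      fun Z : Matrix (Fin p) (Fin q) ℝ => Z * O := by
    ext Z i j
    refine Eq.trans ?_ (Matrix.mul_apply (M := Matrix.of Z) (N := O)).symm
    simp [rightMulCLM, mul_comm]
  refine ⟨Continuous.measurable (by fun_prop), ?_⟩
  rw [heq] at h
  exact h

/-- The plane reflection `(G, Z) ↦ (a G + b Z, b G - a Z)`, on functions of two indices. -/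
noncomputable def reflectCLM (p q : ℕ) (a b : ℝ) :
    ((Fin p → Fin q → ℝ) × (Fin p → Fin q → ℝ)) →L[ℝ]
      ((Fin p → Fin q → ℝ) × (Fin p → Fin q → ℝ)) :=
  ContinuousLinearMap.prod
    (a • ContinuousLinearMap.fst ℝ _ _ + b • ContinuousLinearMap.snd ℝ _ _)
    (b • ContinuousLinearMap.fst ℝ _ _ - a • ContinuousLinearMap.snd ℝ _ _)

/-- The orthogonal matrix with rows `(a, b)` and `(b, -a)` acts on each pair of corresponding
entries. -/
lemma measurePreserving_reflect (p q : ℕ) {a b : ℝ} (hab : a ^ 2 + b ^ 2 = 1) :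
    MeasurePreserving (fun GZ : Matrix (Fin p) (Fin q) ℝ × Matrix (Fin p) (Fin q) ℝ =>
        (a • GZ.1 + b • GZ.2, b • GZ.1 - a • GZ.2))
      ((stdNormal p q).prod (stdNormal p q)) ((stdNormal p q).prod (stdNormal p q)) := by
  have h : ((stdNormalFun p q).prod (stdNormalFun p q)).map (reflectCLM p q a b) =
      (stdNormalFun p q).prod (stdNormalFun p q) := by
    have : IsProbabilityMeasure
        (((stdNormalFun p q).prod (stdNormalFun p q)).map (reflectCLM p q a b)) :=
      Measure.isProbabilityMeasure_map (by fun_prop)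
    apply Measure.ext_of_charFunDual
    ext L
    rw [charFunDual_map, charFunDual_prod, charFunDual_prod]
    simp_rw [charFunDual_stdNormalFun, ← Complex.exp_add]
    congr 1
    rw [← add_div, ← add_div]
    congr 1
    rw [← neg_add, ← neg_add]
    congr 1
    norm_cast
    simp_rw [← Finset.sum_add_distrib]
    refine Finset.sum_congr rfl fun i _ => Finset.sum_congr rfl fun j _ => ?_
    set E : Fin p → Fin q → ℝ := Pi.single i (Pi.single j 1)
    have h1 : reflectCLM p q a b (E, 0) = a • (E, 0) + b • (0, E) := by
      simp [reflectCLM]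
    have h2 : reflectCLM p q a b (0, E) = b • (E, 0) - a • (0, E) := by
      simp [reflectCLM]
    simp only [ContinuousLinearMap.comp_apply, ContinuousLinearMap.inl_apply,
      ContinuousLinearMap.inr_apply, h1, h2, map_add, map_sub, map_smul, smul_eq_mul]
    linear_combination (L (E, 0) ^ 2 + L (0, E) ^ 2) * hab
  exact ⟨Continuous.measurable (by fun_prop), h⟩

/-! ### Level sets of the Gram determinant are null -/

lemma absolutelyContinuous_pi {X : Type*} [MeasurableSpace X] {μ ν : Measure X} [SigmaFinite μ]
    [SigmaFinite ν] (h : μ ≪ ν) (n : ℕ) :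
    Measure.pi (fun _ : Fin n => μ) ≪ Measure.pi (fun _ : Fin n => ν) := by
  induction n with
  | zero =>
    rw [Measure.pi_of_empty, Measure.pi_of_empty]
  | succ n ih =>
    have h1 := (measurePreserving_piFinSuccAbove (fun _ : Fin (n + 1) => μ) 0).symm
    have h2 := (measurePreserving_piFinSuccAbove (fun _ : Fin (n + 1) => ν) 0).symm
    rw [← h1.map_eq, ← h2.map_eq]
    exact (h.prod ih).map h1.measurable

lemma exists_polynomial_det_gram {p q : ℕ} (A B : Matrix (Fin p) (Fin q) ℝ) :
    ∃ P : Polynomial ℝ, ∀ t : ℝ, P.eval t = ((A + t • B)ᵀ * (A + t • B)).det := by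
  refine ⟨((A.map Polynomial.C + (Polynomial.X : Polynomial ℝ) • B.map Polynomial.C)ᵀ *
    (A.map Polynomial.C + (Polynomial.X : Polynomial ℝ) • B.map Polynomial.C)).det, fun t => ?_⟩
  rw [← Polynomial.coe_evalRingHom, RingHom.map_det]
  congr 1
  ext i j
  simp [Matrix.mul_apply, Polynomial.eval_finsetSum, mul_comm t]

/-- The determinant grows like `t ^ (2 * q)`, with leading coefficient `det (Eᵀ * E) = 1`, so it is
not constant when `q ≥ 1`. The substitution `s = t⁻¹` turns this into two incompatible limits at `s
= 0`. -/
lemma exists_det_gram_add_smul_ne {p q : ℕ} (hq : 1 ≤ q) (A E : Matrix (Fin p) (Fin q) ℝ)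
    (hE : Eᵀ * E = 1) (c : ℝ) : ∃ t : ℝ, ((A + t • E)ᵀ * (A + t • E)).det ≠ c := by
  by_contra! hcon
  have hs : ∀ s : ℝ, s ≠ 0 → ((s • A + E)ᵀ * (s • A + E)).det = (s ^ 2) ^ q * c := by
    intro s hs
    have : s • A + E = s • (A + s⁻¹ • E) := by
      rw [smul_add, smul_smul, mul_inv_cancel₀ hs, one_smul]
    rw [this, transpose_smul, smul_mul, Matrix.mul_smul, smul_smul, det_smul, hcon]
    simp [sq]
  have hc1 : Tendsto (fun s : ℝ => ((s • A + E)ᵀ * (s • A + E)).det) (𝓝[≠] 0) (𝓝 1) := by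
    have : Continuous fun s : ℝ => ((s • A + E)ᵀ * (s • A + E)).det := by fun_prop
    have h := (this.tendsto 0).mono_left (nhdsWithin_le_nhds (s := {0}ᶜ))
    simpa [hE] using h
  have hc2 : Tendsto (fun s : ℝ => (s ^ 2) ^ q * c) (𝓝[≠] 0) (𝓝 0) := by
    have : Continuous fun s : ℝ => (s ^ 2) ^ q * c := by fun_prop
    have h := (this.tendsto 0).mono_left (nhdsWithin_le_nhds (s := {0}ᶜ))
    simpa [show q ≠ 0 by omega] using h
  have hc3 : Tendsto (fun s : ℝ => ((s • A + E)ᵀ * (s • A + E)).det) (𝓝[≠] 0) (𝓝 0) :=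
    hc2.congr' (by filter_upwards [self_mem_nhdsWithin] with s h using (hs s h).symm)
  exact one_ne_zero (tendsto_nhds_unique hc1 hc3)

/-- Lebesgue measure on `p × q` matrices. -/
noncomputable def lebesgue (p q : ℕ) : Measure (Matrix (Fin p) (Fin q) ℝ) :=
  Measure.pi (fun _ : Fin p => Measure.pi (fun _ : Fin q => (volume : Measure ℝ)))

instance (p q : ℕ) : (lebesgue p q).IsAddRightInvariant :=
  inferInstanceAs (Measure.IsAddRightInvariant
    (Measure.pi (fun _ : Fin p => Measure.pi (fun _ : Fin q => (volume : Measure ℝ)))))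

instance (p q : ℕ) : SigmaFinite (lebesgue p q) :=
  inferInstanceAs (SigmaFinite
    (Measure.pi (fun _ : Fin p => Measure.pi (fun _ : Fin q => (volume : Measure ℝ)))))

lemma stdNormal_absolutelyContinuous (p q : ℕ) : stdNormal p q ≪ lebesgue p q :=
  absolutelyContinuous_pi (absolutelyContinuous_pi
    (gaussianReal_absolutelyContinuous 0 one_ne_zero) q) p

lemma exists_orthonormal_columns {p q : ℕ} (hpq : q ≤ p) :
    ∃ E : Matrix (Fin p) (Fin q) ℝ, Eᵀ * E = 1 := by
  refine ⟨Matrix.of fun i j => if i = Fin.castLE hpq j then 1 else 0, ?_⟩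
  ext i j
  simp [Matrix.mul_apply, Matrix.one_apply, eq_comm]

lemma volume_line_det_gram_eq_zero {p q : ℕ} (hq : 1 ≤ q) (A E : Matrix (Fin p) (Fin q) ℝ)
    (hE : Eᵀ * E = 1) {b : ℝ} (hb : b ≠ 0) (c : ℝ) :
    volume {t : ℝ | ((A + t • b • E)ᵀ * (A + t • b • E)).det = c} = 0 := by
  obtain ⟨P, hP⟩ := exists_polynomial_det_gram A (b • E)
  obtain ⟨t, ht⟩ := exists_det_gram_add_smul_ne hq A E hE c
  have hne : P - Polynomial.C c ≠ 0 := by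
    intro h0
    have h1 : P.eval (t / b) = c := by
      rw [sub_eq_zero.1 h0, Polynomial.eval_C]
    rw [hP, smul_smul, div_mul_cancel₀ _ hb] at h1
    exact ht h1
  refine Set.Finite.measure_zero (((P - Polynomial.C c).rootSet_finite ℝ).subset fun s hs => ?_) _
  rw [Polynomial.mem_rootSet]
  refine ⟨hne, ?_⟩
  have : P.eval s = c := (hP s).trans hs
  simp [this]

/-- On every line in direction `E` the determinant is a nonconstant polynomial, so the level set
meets the line in a null set. By Fubini almost every translate of the level set along `E` is null,
and translation invariance carries this back from a single one. -/
lemma ae_det_gram_ne {p q : ℕ} (hq : 1 ≤ q) (hpq : q ≤ p)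
    (A : Matrix (Fin p) (Fin q) ℝ) {b : ℝ} (hb : b ≠ 0) (c : ℝ) :
    ∀ᵐ Z ∂(stdNormal p q), ((A + b • Z)ᵀ * (A + b • Z)).det ≠ c := by
  refine (stdNormal_absolutelyContinuous p q).ae_le ?_
  obtain ⟨E, hE⟩ := exists_orthonormal_columns hpq
  set F : Matrix (Fin p) (Fin q) ℝ → ℝ := fun Z => ((A + b • Z)ᵀ * (A + b • Z)).det with hF
  have hFc : Continuous F := by fun_prop
  have hline : ∀ Z, volume {t : ℝ | F (Z + t • E) = c} = 0 := by
    intro Z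
    have := volume_line_det_gram_eq_zero hq (A + b • Z) E hE hb c
    simpa only [hF, smul_add, smul_comm b, add_assoc] using this
  have hmeas : MeasurableSet {w : ℝ × Matrix (Fin p) (Fin q) ℝ | F (w.2 + w.1 • E) = c} :=
    (isClosed_eq (by fun_prop : Continuous fun w : ℝ × Matrix (Fin p) (Fin q) ℝ =>
        F (w.2 + w.1 • E)) continuous_const).measurableSet
  have hprod : ((volume : Measure ℝ).prod (lebesgue p q))
      {w : ℝ × Matrix (Fin p) (Fin q) ℝ | F (w.2 + w.1 • E) = c} = 0 := by
    rw [Measure.prod_apply_symm hmeas]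
    simp only [Set.preimage_ofPred_eq, hline, lintegral_zero]
  obtain ⟨t, ht⟩ := ((Measure.measure_prod_null hmeas).1 hprod).exists
  have h := measure_preimage_add_right (lebesgue p q) (t • E) {Z | F Z = c}
  change ∀ᵐ Z ∂(lebesgue p q), _
  rw [ae_iff]
  simp only [not_not, ne_eq]
  exact h.symm.trans ht

/-! ### Square roots and orthogonal factors -/

lemma sqrt_mul_sqrt {q : ℕ} {A : Matrix (Fin q) (Fin q) ℝ} (hA : A.PosSemidef) :
    CFC.sqrt A * CFC.sqrt A = A :=
  CFC.sqrt_mul_sqrt_self A hA.nonneg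

lemma transpose_sqrt {q : ℕ} (A : Matrix (Fin q) (Fin q) ℝ) : (CFC.sqrt A)ᵀ = CFC.sqrt A := by
  have h := (CFC.sqrt_nonneg A).posSemidef.1
  rwa [IsHermitian, conjTranspose_eq_transpose_of_trivial] at h

lemma isUnit_det_sqrt {q : ℕ} {A : Matrix (Fin q) (Fin q) ℝ} (hA : A.PosDef) :
    IsUnit (CFC.sqrt A).det := by
  have h : (CFC.sqrt A).det * (CFC.sqrt A).det = A.det := by
    rw [← det_mul, sqrt_mul_sqrt hA.posSemidef]
  rw [isUnit_iff_ne_zero]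
  intro h0
  rw [h0, zero_mul] at h
  exact hA.det_pos.ne h

lemma sqrt_inv_eq {q : ℕ} {A : Matrix (Fin q) (Fin q) ℝ} (hA : A.PosSemidef) :
    CFC.sqrt A⁻¹ = (CFC.sqrt A)⁻¹ := hA.inv_sqrt.symm

lemma posSemidef_transpose_mul_self {p q : ℕ} (A : Matrix (Fin p) (Fin q) ℝ) :
    (Aᵀ * A).PosSemidef := by
  simpa [conjTranspose_eq_transpose_of_trivial] using posSemidef_conjTranspose_mul_self A

lemma posDef_transpose_mul_self {p q : ℕ} {A : Matrix (Fin p) (Fin q) ℝ}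
    (h : (Aᵀ * A).det ≠ 0) : (Aᵀ * A).PosDef :=
  (posSemidef_transpose_mul_self A).posDef_iff_det_ne_zero.2 h

lemma measurableSet_posSemidef (q : ℕ) :
    MeasurableSet {A : Matrix (Fin q) (Fin q) ℝ | A.PosSemidef} := by
  have h : {A : Matrix (Fin q) (Fin q) ℝ | A.PosSemidef} =
      {A | Aᵀ = A} ∩ ⋂ x : Fin q → ℝ, {A | 0 ≤ x ⬝ᵥ (A *ᵥ x)} := by
    ext A
    simp [posSemidef_iff_dotProduct_mulVec, IsHermitian]
  rw [h]
  refine (IsClosed.inter (isClosed_eq (by fun_prop) continuous_id)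
    (isClosed_iInter fun x => isClosed_le continuous_const ?_)).measurableSet
  fun_prop

lemma measurableSet_posDef (q : ℕ) :
    MeasurableSet {A : Matrix (Fin q) (Fin q) ℝ | A.PosDef} := by
  have h : {A : Matrix (Fin q) (Fin q) ℝ | A.PosDef} =
      {A | A.PosSemidef} ∩ {A | A.det ≠ 0} := by
    ext A
    exact ⟨fun hA => ⟨hA.posSemidef, hA.det_pos.ne'⟩, fun hA => hA.1.posDef_iff_det_ne_zero.2 hA.2⟩
  rw [h]
  refine (measurableSet_posSemidef q).inter (IsOpen.measurableSet ?_)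
  exact isOpen_ne_fun (by fun_prop) continuous_const

lemma sqrt_of_not_posSemidef {q : ℕ} {A : Matrix (Fin q) (Fin q) ℝ} (hA : ¬ A.PosSemidef) :
    CFC.sqrt A = 0 := by
  rw [CFC.sqrt, cfcₙ_apply_of_not_predicate]
  rwa [nonneg_iff_posSemidef]

/-- On the positive semidefinite cone the square root inverts squaring, which is continuous and
injective there, so preimages are Borel by Lusin–Souslin. Off the cone `CFC.sqrt` takes the default
value 0. -/
lemma measurable_sqrt (q : ℕ) :
    Measurable (CFC.sqrt : Matrix (Fin q) (Fin q) ℝ → Matrix (Fin q) (Fin q) ℝ) := by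
  intro s hs
  set K := {A : Matrix (Fin q) (Fin q) ℝ | A.PosSemidef} with hK
  have h : CFC.sqrt ⁻¹' s = (fun B => B * B) '' (s ∩ K) ∪ (CFC.sqrt ⁻¹' s ∩ Kᶜ) := by
    ext A
    constructor
    · intro hA
      by_cases hAK : A ∈ K
      · exact Or.inl ⟨CFC.sqrt A, ⟨hA, (CFC.sqrt_nonneg A).posSemidef⟩, sqrt_mul_sqrt hAK⟩
      · exact Or.inr ⟨hA, hAK⟩
    · rintro (⟨B, ⟨hB, hBK⟩, rfl⟩ | hA)
      · rw [Set.mem_preimage, CFC.sqrt_unique rfl (nonneg_iff_posSemidef.2 hBK)]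
        exact hB
      · exact hA.1
  have hKm : MeasurableSet K := measurableSet_posSemidef q
  rw [h]
  refine MeasurableSet.union ?_ ?_
  · refine (hs.inter hKm).image_of_continuousOn_injOn (by fun_prop) ?_
    intro B hB C hC hBC
    have h1 := CFC.sqrt_unique (a := B * B) rfl (nonneg_iff_posSemidef.2 hB.2)
    have h2 := CFC.sqrt_unique (a := B * B) hBC.symm (nonneg_iff_posSemidef.2 hC.2)
    exact h1.symm.trans h2
  · by_cases h0 : (0 : Matrix (Fin q) (Fin q) ℝ) ∈ s
    · convert hKm.compl using 1
      ext A
      simp only [Set.mem_inter_iff, Set.mem_preimage, Set.mem_compl_iff, and_iff_right_iff_imp]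
      intro hA
      rwa [sqrt_of_not_posSemidef hA]
    · convert MeasurableSet.empty using 1
      ext A
      simp only [Set.mem_inter_iff, Set.mem_preimage, Set.mem_compl_iff, Set.mem_empty_iff_false,
        iff_false, not_and, not_not]
      intro hA
      by_contra hAK
      rw [sqrt_of_not_posSemidef hAK] at hA
      exact h0 hA

lemma measurable_matrix_inv (q : ℕ) :
    Measurable (fun A : Matrix (Fin q) (Fin q) ℝ => A⁻¹) := by
  have h : (fun A : Matrix (Fin q) (Fin q) ℝ => A⁻¹) = fun A => (A.det)⁻¹ • A.adjugate := by
    ext A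
    rw [Matrix.inv_def, Ring.inverse_eq_inv']
  rw [h]
  have h1 : Measurable fun A : Matrix (Fin q) (Fin q) ℝ => (A.det)⁻¹ :=
    (Continuous.measurable (by fun_prop : Continuous fun A : Matrix (Fin q) (Fin q) ℝ =>
      A.det)).inv
  have h2 : Measurable fun A : Matrix (Fin q) (Fin q) ℝ => A.adjugate :=
    Continuous.measurable (by fun_prop)
  exact h1.smul h2

/-- Matrices with the same invertible Gram matrix differ by an orthogonal left factor. -/
lemma exists_orthogonal_mul_eq {p q : ℕ} {A B : Matrix (Fin p) (Fin q) ℝ}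
    (h : Aᵀ * A = Bᵀ * B) (hB : (Bᵀ * B).det ≠ 0) :
    ∃ R : Matrix (Fin p) (Fin p) ℝ, Rᵀ * R = 1 ∧ A = R * B := by
  let a := toEuclideanLin (𝕜 := ℝ) A
  let b := toEuclideanLin (𝕜 := ℝ) B
  have hinner : ∀ (C : Matrix (Fin p) (Fin q) ℝ) (v : EuclideanSpace ℝ (Fin q)),
      ‖toEuclideanLin (𝕜 := ℝ) C v‖ ^ 2 = v.ofLp ⬝ᵥ ((Cᵀ * C) *ᵥ v.ofLp) := by
    intro C v
    rw [EuclideanSpace.real_norm_sq_eq, ← mulVec_mulVec, dotProduct_mulVec, vecMul_transpose]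
    simp [dotProduct, sq]
  have hnorm : ∀ v, ‖a v‖ = ‖b v‖ := by
    intro v
    rw [← sq_eq_sq₀ (norm_nonneg _) (norm_nonneg _), hinner, hinner, h]
  have hbinj : Function.Injective b := by
    rw [← LinearMap.ker_eq_bot, LinearMap.ker_eq_bot']
    intro v hv
    have h1 : B *ᵥ v.ofLp = 0 := by
      have := congrArg WithLp.ofLp hv
      simpa [b] using this
    have h2 : (Bᵀ * B) *ᵥ v.ofLp = 0 := by rw [← mulVec_mulVec, h1, mulVec_zero]
    have h3 := eq_zero_of_mulVec_eq_zero hB h2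
    ext i
    simp [h3]
  let e := LinearEquiv.ofInjective b hbinj
  -- `B v ↦ A v` is a well-defined isometry on the range of `B`; its isometric extension to the
  -- whole space is the orthogonal factor.
  let L : LinearMap.range b →ₗᵢ[ℝ] EuclideanSpace ℝ (Fin p) :=
    { toLinearMap := a ∘ₗ e.symm.toLinearMap
      norm_map' := by
        intro s
        obtain ⟨v, rfl⟩ := e.surjective s
        simp only [LinearMap.comp_apply, LinearEquiv.coe_coe, LinearEquiv.symm_apply_apply]
        rw [hnorm]
        rfl }
  let R : Matrix (Fin p) (Fin p) ℝ := toEuclideanLin.symm L.extend.toLinearMap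
  have hR : ∀ v, toEuclideanLin R v = L.extend v := by
    intro v
    simp [R]
  refine ⟨R, ?_, ?_⟩
  · have key : ∀ i j, inner ℝ (toEuclideanLin R (EuclideanSpace.single i 1))
        (toEuclideanLin R (EuclideanSpace.single j 1)) = (1 : Matrix (Fin p) (Fin p) ℝ) i j := by
      intro i j
      rw [hR, hR, LinearIsometry.inner_map_map]
      simp [Matrix.one_apply, EuclideanSpace.inner_single_left, PiLp.single_apply]
    ext i j
    rw [← key, Matrix.mul_apply]
    simp [PiLp.inner_apply, mul_comm]
  · have h1 : ∀ v, a v = toEuclideanLin R (b v) := by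
      intro v
      rw [hR]
      have h2 : b v = (e v : EuclideanSpace ℝ (Fin p)) := rfl
      rw [h2, LinearIsometry.extend_apply]
      change a v = a (e.symm (e v))
      rw [LinearEquiv.symm_apply_apply]
    apply toEuclideanLin.injective
    refine LinearMap.ext fun v => ?_
    refine (h1 v).trans ?_
    ext i
    simp [b]

/-! ### The law of the determinant of the noise -/

/-- Here `K` plays the role of `V^{1/2}`. The aim is a factorisation `x = R G O K` with the same
outer factors as the rotated increment `R Z O K`; then `a x + b w = R (a G + b Z) O K`, and the
outer factors contribute only `det K ^ 2`. -/
lemma exists_orthogonal_det_gram_eq {p q : ℕ} {G x : Matrix (Fin p) (Fin q) ℝ}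
    {K S : Matrix (Fin q) (Fin q) ℝ} (hG : (Gᵀ * G).det ≠ 0) (hS : IsUnit S.det)
    (hSt : Sᵀ = S) (hKt : Kᵀ = K) (hx : xᵀ * x = S * S)
    (hK : K * K = ((G * S⁻¹)ᵀ * (G * S⁻¹))⁻¹) (a b : ℝ) :
    ∃ (R : Matrix (Fin p) (Fin p) ℝ) (O : Matrix (Fin q) (Fin q) ℝ),
      Rᵀ * R = 1 ∧ O * Oᵀ = 1 ∧ ∀ Z : Matrix (Fin p) (Fin q) ℝ,
        ((a • x + b • (R * Z * O * K))ᵀ * (a • x + b • (R * Z * O * K))).det =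
          (S * S).det / (Gᵀ * G).det * ((a • G + b • Z)ᵀ * (a • G + b • Z)).det := by
  have hSit : (S⁻¹)ᵀ = S⁻¹ := by rw [transpose_nonsing_inv, hSt]
  have hX : (G * S⁻¹)ᵀ * (G * S⁻¹) = S⁻¹ * (Gᵀ * G) * S⁻¹ := by
    rw [transpose_mul, hSit]
    simp only [Matrix.mul_assoc]
  have hGu : IsUnit (Gᵀ * G).det := isUnit_iff_ne_zero.2 hG
  have hKK : K * K = S * (Gᵀ * G)⁻¹ * S := by
    rw [hK, hX, Matrix.mul_inv_rev, Matrix.mul_inv_rev, nonsing_inv_nonsing_inv _ hS, Matrix.mul_assoc]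
  have hdetKK : K.det * K.det = (S * S).det / (Gᵀ * G).det := by
    rw [← det_mul, hKK, det_mul, det_mul, det_nonsing_inv, Ring.inverse_eq_inv', det_mul S S]
    field_simp
  have hKu : IsUnit K.det := by
    rw [isUnit_iff_ne_zero]
    intro h0
    rw [h0, zero_mul, det_mul, eq_comm, div_eq_zero_iff] at hdetKK
    rcases hdetKK with h | h
    · exact hS.ne_zero (mul_self_eq_zero.1 h)
    · exact hG h
  have hKit : (K⁻¹)ᵀ = K⁻¹ := by rw [transpose_nonsing_inv, hKt]
  have hKiKi : K⁻¹ * K⁻¹ = S⁻¹ * (Gᵀ * G) * S⁻¹ := by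
    rw [← Matrix.mul_inv_rev, hKK, Matrix.mul_inv_rev, Matrix.mul_inv_rev, nonsing_inv_nonsing_inv _ hGu]
    simp only [Matrix.mul_assoc]
  -- `Cᵀ C` is the Gram matrix of `G` and `C Cᵀ` that of `x K⁻¹`; the polar factor of `C` rotates
  -- one into the other.
  set C : Matrix (Fin q) (Fin q) ℝ := K⁻¹ * S with hC
  have hCC : Cᵀ * C = Gᵀ * G := by
    calc Cᵀ * C = S * (K⁻¹ * K⁻¹) * S := by
          rw [hC, transpose_mul, hSt, hKit]
          simp only [Matrix.mul_assoc]
      _ = (S * S⁻¹) * (Gᵀ * G) * (S⁻¹ * S) := by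
          rw [hKiKi]
          simp only [Matrix.mul_assoc]
      _ = Gᵀ * G := by
          rw [mul_nonsing_inv _ hS, nonsing_inv_mul _ hS, Matrix.one_mul, Matrix.mul_one]
  have hCdet : C.det ≠ 0 := by
    intro h0
    apply hG
    rw [← hCC, det_mul, h0, mul_zero]
  set A : Matrix (Fin p) (Fin q) ℝ := x * K⁻¹ with hA
  have hAA : Aᵀ * A = C * Cᵀ := by
    calc Aᵀ * A = K⁻¹ * (xᵀ * x) * K⁻¹ := by
          rw [hA, transpose_mul, hKit]
          simp only [Matrix.mul_assoc]
      _ = C * Cᵀ := by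
          rw [hx, hC, transpose_mul, hSt, hKit]
          simp only [Matrix.mul_assoc]
  have hCCpsd : (C * Cᵀ).PosSemidef := by
    simpa using posSemidef_transpose_mul_self Cᵀ
  set H := CFC.sqrt (C * Cᵀ) with hH
  have hHt : Hᵀ = H := transpose_sqrt _
  obtain ⟨R', hR', hHR⟩ := exists_orthogonal_mul_eq (A := H) (B := Cᵀ)
    (by rw [hHt, transpose_transpose, sqrt_mul_sqrt hCCpsd])
    (by rw [transpose_transpose, det_mul, det_transpose]; exact mul_ne_zero hCdet hCdet)
  have hHC : H = C * R'ᵀ := by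
    rw [← hHt, hHR, transpose_mul, transpose_transpose]
  have hGO : (G * R'ᵀ)ᵀ * (G * R'ᵀ) = C * Cᵀ := by
    calc (G * R'ᵀ)ᵀ * (G * R'ᵀ) = R' * (Gᵀ * G) * R'ᵀ := by
          rw [transpose_mul, transpose_transpose]
          simp only [Matrix.mul_assoc]
      _ = Hᵀ * H := by
          rw [← hCC, hHC, transpose_mul C, transpose_transpose]
          simp only [Matrix.mul_assoc]
      _ = C * Cᵀ := by rw [hHt, sqrt_mul_sqrt hCCpsd]
  obtain ⟨R, hR, hAR⟩ := exists_orthogonal_mul_eq (A := A) (B := G * R'ᵀ)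
    (by rw [hAA, hGO]) (by
      rw [hGO, det_mul, det_transpose]; exact mul_ne_zero hCdet hCdet)
  refine ⟨R, R'ᵀ, hR, by rw [transpose_transpose]; exact hR', fun Z => ?_⟩
  have hxK : x = R * G * R'ᵀ * K := by
    have : x = A * K := by rw [hA, Matrix.mul_assoc, nonsing_inv_mul _ hKu, Matrix.mul_one]
    rw [this, hAR]
    simp only [Matrix.mul_assoc]
  have hy : a • x + b • (R * Z * R'ᵀ * K) = R * (a • G + b • Z) * R'ᵀ * K := by
    rw [hxK]
    simp only [Matrix.mul_add, Matrix.add_mul, Matrix.mul_smul, Matrix.smul_mul]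
  set M := a • G + b • Z
  have hgram : (R * M * R'ᵀ * K)ᵀ * (R * M * R'ᵀ * K) = K * R' * (Mᵀ * M) * R'ᵀ * K := by
    calc (R * M * R'ᵀ * K)ᵀ * (R * M * R'ᵀ * K)
        = K * R' * (Mᵀ * (Rᵀ * R) * M) * R'ᵀ * K := by
          simp only [transpose_mul, transpose_transpose, hKt, Matrix.mul_assoc]
      _ = _ := by rw [hR, Matrix.mul_one]
  have hdetR : R'.det * R'.det = 1 := by
    have := congrArg det hR'
    rwa [det_mul, det_transpose, det_one] at this
  rw [hy, hgram, det_mul, det_mul, det_mul, det_mul, det_transpose, ← hdetKK]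
  linear_combination K.det * K.det * (Mᵀ * M).det * hdetR

lemma gram_eq {p q : ℕ} {U : Matrix (Fin p) (Fin p) ℝ} (hU : U.PosDef)
    (y : Matrix (Fin p) (Fin q) ℝ) :
    gram U y = ((CFC.sqrt U)⁻¹ * y)ᵀ * ((CFC.sqrt U)⁻¹ * y) := by
  have h : U⁻¹ = (CFC.sqrt U)⁻¹ * (CFC.sqrt U)⁻¹ := by
    rw [← Matrix.mul_inv_rev, sqrt_mul_sqrt hU.posSemidef]
  rw [gram, h, transpose_mul, transpose_nonsing_inv, transpose_sqrt]
  simp only [Matrix.mul_assoc]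

/-! ### Gaussian realisation of the noise. -/

lemma continuous_circ_gram {p q : ℕ} (U : Matrix (Fin p) (Fin p) ℝ)
    (S : Matrix (Fin q) (Fin q) ℝ) :
    Continuous (fun y : Matrix (Fin p) (Fin q) ℝ => circ (gram U y) S) := by
  unfold circ gram
  fun_prop

lemma continuous_circ {q : ℕ} (S : Matrix (Fin q) (Fin q) ℝ) :
    Continuous (fun e => circ e S) := by
  unfold circ
  fun_prop

/-- The Inverse-Wishart matrix with scale `T` built from a standard normal matrix. -/
noncomputable def invWishartOf {p q : ℕ} (T : Matrix (Fin q) (Fin q) ℝ)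
    (G : Matrix (Fin p) (Fin q) ℝ) : Matrix (Fin q) (Fin q) ℝ :=
  ((affineNormal 0 1 T⁻¹ G)ᵀ * affineNormal 0 1 T⁻¹ G)⁻¹

/-- The noise `ε` built from two independent standard normal matrices. -/
noncomputable def noiseOf {p q : ℕ} (ρ : ℝ) (U : Matrix (Fin p) (Fin p) ℝ)
    (x : Matrix (Fin p) (Fin q) ℝ) (GZ : Matrix (Fin p) (Fin q) ℝ × Matrix (Fin p) (Fin q) ℝ) :
    Matrix (Fin q) (Fin q) ℝ :=
  circ (gram U (Real.sqrt ρ • x +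
    Real.sqrt (1 - ρ) • affineNormal 0 U (invWishartOf (gram U x) GZ.1) GZ.2)) (gram U x)⁻¹

lemma measurable_invWishartOf {p q : ℕ} (T : Matrix (Fin q) (Fin q) ℝ) :
    Measurable (invWishartOf T : Matrix (Fin p) (Fin q) ℝ → _) := by
  refine (measurable_matrix_inv q).comp (Continuous.measurable ?_)
  unfold affineNormal
  fun_prop

lemma invWishart_eq_map {q : ℕ} (p : ℕ) (T : Matrix (Fin q) (Fin q) ℝ) :
    invWishart p T = (stdNormal p q).map (invWishartOf T) := by
  have h1 : Measurable (affineNormal 0 1 T⁻¹ : Matrix (Fin p) (Fin q) ℝ → _) := by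
    unfold affineNormal
    exact Continuous.measurable (by fun_prop)
  have h2 : Measurable (fun X : Matrix (Fin p) (Fin q) ℝ => X.transpose * X) :=
    Continuous.measurable (by fun_prop)
  rw [invWishart, wishart, matrixNormal, Measure.map_map h2 h1,
    Measure.map_map (measurable_matrix_inv q) (h2.comp h1)]
  rfl

lemma measurable_smul_add_affineNormal {p q : ℕ} (a b : ℝ) (U : Matrix (Fin p) (Fin p) ℝ)
    (x : Matrix (Fin p) (Fin q) ℝ) :
    Measurable (fun VZ : Matrix (Fin q) (Fin q) ℝ × Matrix (Fin p) (Fin q) ℝ =>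
      a • x + b • affineNormal 0 U VZ.1 VZ.2) := by
  have h1 : Continuous (fun VZ : Matrix (Fin q) (Fin q) ℝ × Matrix (Fin p) (Fin q) ℝ =>
      a • x + b • (0 + CFC.sqrt U * VZ.2 * VZ.1)) := by fun_prop
  have h2 : Measurable (fun VZ : Matrix (Fin q) (Fin q) ℝ × Matrix (Fin p) (Fin q) ℝ =>
      (CFC.sqrt VZ.1, VZ.2)) :=
    ((measurable_sqrt q).comp measurable_fst).prodMk measurable_snd
  have h3 := h1.measurable.comp h2
  simp only [Function.comp_def] at h3
  simpa only [affineNormal] using h3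

lemma measurable_proposal {p q : ℕ} (ρ : ℝ) (U : Matrix (Fin p) (Fin p) ℝ)
    (x : Matrix (Fin p) (Fin q) ℝ) :
    Measurable (fun VZ : Matrix (Fin q) (Fin q) ℝ × Matrix (Fin p) (Fin q) ℝ =>
      Real.sqrt ρ • x + Real.sqrt (1 - ρ) • affineNormal 0 U VZ.1 VZ.2) :=
  measurable_smul_add_affineNormal _ _ U x

lemma measurable_noiseOf {p q : ℕ} (ρ : ℝ) (U : Matrix (Fin p) (Fin p) ℝ)
    (x : Matrix (Fin p) (Fin q) ℝ) : Measurable (noiseOf ρ U x) := by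
  have h1 : Measurable (Prod.map (invWishartOf (gram U x)) id :
      Matrix (Fin p) (Fin q) ℝ × Matrix (Fin p) (Fin q) ℝ → _) :=
    (measurable_invWishartOf _).prodMap measurable_id
  have h2 := (measurable_proposal ρ U x).comp h1
  have h3 := (continuous_circ_gram U (gram U x)⁻¹).measurable
  exact h3.comp h2

lemma mpcnNoise_eq_map {p q : ℕ} (ρ : ℝ) (U : Matrix (Fin p) (Fin p) ℝ)
    (x : Matrix (Fin p) (Fin q) ℝ) :
    mpcnNoise ρ U x = ((stdNormal p q).prod (stdNormal p q)).map (noiseOf ρ U x) := by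
  have h1 : (invWishart p (gram U x)).prod (stdNormal p q) =
      ((stdNormal p q).prod (stdNormal p q)).map (Prod.map (invWishartOf (gram U x)) id) := by
    rw [← Measure.map_prod_map _ _ (measurable_invWishartOf _) measurable_id, Measure.map_id,
      invWishart_eq_map]
  have h2 : Measurable (Prod.map (invWishartOf (gram U x)) id :
      Matrix (Fin p) (Fin q) ℝ × Matrix (Fin p) (Fin q) ℝ → _) :=
    (measurable_invWishartOf _).prodMap measurable_id
  rw [mpcnNoise, mpcnProposal, h1, Measure.map_map (measurable_proposal ρ U x) h2]
  exact Measure.map_map (continuous_circ_gram U (gram U x)⁻¹).measurable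
    ((measurable_proposal ρ U x).comp h2)

instance instIsProbabilityMeasureMpcnNoise {p q : ℕ} (ρ : ℝ) (U : Matrix (Fin p) (Fin p) ℝ)
    (x : Matrix (Fin p) (Fin q) ℝ) : IsProbabilityMeasure (mpcnNoise ρ U x) := by
  rw [mpcnNoise_eq_map]
  exact Measure.isProbabilityMeasure_map (measurable_noiseOf ρ U x).aemeasurable

lemma det_circ {q : ℕ} {B : Matrix (Fin q) (Fin q) ℝ} (hB : B.PosSemidef)
    (A : Matrix (Fin q) (Fin q) ℝ) : (circ A B).det = A.det * B.det := by
  have h : (CFC.sqrt B).det * (CFC.sqrt B).det = B.det := by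
    rw [← det_mul, sqrt_mul_sqrt hB]
  rw [circ, det_mul, det_mul, ← h]
  ring

lemma posSemidef_circ {q : ℕ} {A : Matrix (Fin q) (Fin q) ℝ} (hA : A.PosSemidef)
    (B : Matrix (Fin q) (Fin q) ℝ) : (circ A B).PosSemidef := by
  have h := hA.conjTranspose_mul_mul_same (CFC.sqrt B)
  rwa [conjTranspose_eq_transpose_of_trivial, transpose_sqrt] at h

lemma posDef_circ {q : ℕ} {A B : Matrix (Fin q) (Fin q) ℝ} (hA : A.PosDef) (hB : B.PosDef) :
    (circ A B).PosDef := by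
  refine (posSemidef_circ hA.posSemidef B).posDef_iff_det_ne_zero.2 ?_
  rw [det_circ hB.posSemidef]
  exact mul_ne_zero hA.det_pos.ne' hB.det_pos.ne'

lemma posDef_gram {p q : ℕ} {U : Matrix (Fin p) (Fin p) ℝ} (hU : U.PosDef)
    {x : Matrix (Fin p) (Fin q) ℝ} (hx : (gram U x).det ≠ 0) : (gram U x).PosDef := by
  rw [gram_eq hU] at hx ⊢
  exact posDef_transpose_mul_self hx

lemma posSemidef_noiseOf {p q : ℕ} (ρ : ℝ) {U : Matrix (Fin p) (Fin p) ℝ} (hU : U.PosDef)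
    (x : Matrix (Fin p) (Fin q) ℝ)
    (GZ : Matrix (Fin p) (Fin q) ℝ × Matrix (Fin p) (Fin q) ℝ) :
    (noiseOf ρ U x GZ).PosSemidef := by
  refine posSemidef_circ ?_ _
  rw [gram_eq hU]
  exact posSemidef_transpose_mul_self _

/-- The ratio of Gram determinants of `a G + b Z` and `G`. -/
noncomputable def detRatio {p q : ℕ} (a b : ℝ)
    (GZ : Matrix (Fin p) (Fin q) ℝ × Matrix (Fin p) (Fin q) ℝ) : ℝ :=
  ((a • GZ.1 + b • GZ.2)ᵀ * (a • GZ.1 + b • GZ.2)).det / (GZ.1ᵀ * GZ.1).det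

lemma measurable_detRatio {p q : ℕ} (a b : ℝ) :
    Measurable (detRatio a b :
      Matrix (Fin p) (Fin q) ℝ × Matrix (Fin p) (Fin q) ℝ → ℝ) := by
  refine Measurable.div (Continuous.measurable ?_) (Continuous.measurable ?_) <;> fun_prop

/-- Multiplication by `U^{-1/2}` reduces to identity row covariance, and conjugation by `(gram U
x)^{-1/2}` cancels the factor `det (gram U x)`. The rotations depend on `G` but not on `Z`. -/
lemma exists_orthogonal_det_noiseOf {p q : ℕ} (ρ : ℝ) {U : Matrix (Fin p) (Fin p) ℝ}
    (hU : U.PosDef) {x : Matrix (Fin p) (Fin q) ℝ} (hx : (gram U x).det ≠ 0)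
    {G : Matrix (Fin p) (Fin q) ℝ} (hG : (Gᵀ * G).det ≠ 0) :
    ∃ (R : Matrix (Fin p) (Fin p) ℝ) (O : Matrix (Fin q) (Fin q) ℝ),
      Rᵀ * R = 1 ∧ O * Oᵀ = 1 ∧ ∀ Z : Matrix (Fin p) (Fin q) ℝ,
        (noiseOf ρ U x (G, R * Z * O)).det =
          detRatio (Real.sqrt ρ) (Real.sqrt (1 - ρ)) (G, Z) := by
  set T := gram U x with hT
  have hTp : T.PosDef := posDef_gram hU hx
  have hV : invWishartOf T G = ((G * (CFC.sqrt T)⁻¹)ᵀ * (G * (CFC.sqrt T)⁻¹))⁻¹ := by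
    have h1 : affineNormal 0 1 T⁻¹ G = G * (CFC.sqrt T)⁻¹ := by
      rw [affineNormal, CFC.sqrt_one, Matrix.one_mul, zero_add, sqrt_inv_eq hTp.posSemidef]
    rw [invWishartOf, h1]
  have hVp : (invWishartOf T G).PosSemidef := by
    rw [hV]
    exact (posSemidef_transpose_mul_self _).inv
  obtain ⟨R, O, hR, hO, h⟩ := exists_orthogonal_det_gram_eq (G := G)
    (x := (CFC.sqrt U)⁻¹ * x) (K := CFC.sqrt (invWishartOf T G)) (S := CFC.sqrt T) hG
    (isUnit_det_sqrt hTp) (transpose_sqrt _) (transpose_sqrt _)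
    (by rw [← gram_eq hU, sqrt_mul_sqrt hTp.posSemidef])
    (by rw [sqrt_mul_sqrt hVp, hV]) (Real.sqrt ρ) (Real.sqrt (1 - ρ))
  refine ⟨R, O, hR, hO, fun Z => ?_⟩
  rw [noiseOf, det_circ hTp.inv.posSemidef, gram_eq hU]
  have hy : (CFC.sqrt U)⁻¹ * (Real.sqrt ρ • x +
      Real.sqrt (1 - ρ) • affineNormal 0 U (invWishartOf T G) (R * Z * O)) =
      Real.sqrt ρ • ((CFC.sqrt U)⁻¹ * x) +
        Real.sqrt (1 - ρ) • (R * Z * O * CFC.sqrt (invWishartOf T G)) := by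
    rw [affineNormal, zero_add, Matrix.mul_add, Matrix.mul_smul, Matrix.mul_smul]
    congr 2
    rw [← Matrix.mul_assoc, ← Matrix.mul_assoc, nonsing_inv_mul _ (isUnit_det_sqrt hU),
      Matrix.one_mul]
  simp only [← hT]
  rw [hy, h Z, sqrt_mul_sqrt hTp.posSemidef, det_nonsing_inv, Ring.inverse_eq_inv', detRatio]
  have := hTp.det_pos.ne'
  field_simp

lemma ae_det_transpose_mul_self_ne_zero {p q : ℕ} (hq : 1 ≤ q) (hpq : q ≤ p) :
    ∀ᵐ G ∂(stdNormal p q), (Gᵀ * G).det ≠ 0 := by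
  simpa using ae_det_gram_ne hq hpq 0 one_ne_zero 0

lemma map_det_mpcnNoise {p q : ℕ} (hq : 1 ≤ q) (hpq : q ≤ p) (ρ : ℝ)
    {U : Matrix (Fin p) (Fin p) ℝ} (hU : U.PosDef) {x : Matrix (Fin p) (Fin q) ℝ}
    (hx : (gram U x).det ≠ 0) :
    (mpcnNoise ρ U x).map det = ((stdNormal p q).prod (stdNormal p q)).map
      (detRatio (Real.sqrt ρ) (Real.sqrt (1 - ρ))) := by
  have hdet : Measurable (det : Matrix (Fin q) (Fin q) ℝ → ℝ) :=
    Continuous.measurable (by fun_prop)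
  have hn := measurable_noiseOf ρ U x
  have hr := measurable_detRatio (p := p) (q := q) (Real.sqrt ρ) (Real.sqrt (1 - ρ))
  rw [mpcnNoise_eq_map, Measure.map_map hdet hn]
  ext B hB
  rw [Measure.map_apply (hdet.comp hn) hB, Measure.map_apply hr hB,
    Measure.prod_apply ((hdet.comp hn) hB), Measure.prod_apply (hr hB)]
  -- The slices at fixed `G` have equal mass because `Z ↦ R Z O` preserves the Gaussian law;
  -- comparing slices avoids any measurable choice of `R` and `O` in `G`.
  refine lintegral_congr_ae ?_
  filter_upwards [ae_det_transpose_mul_self_ne_zero hq hpq] with G hG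
  obtain ⟨R, O, hR, hO, h⟩ := exists_orthogonal_det_noiseOf ρ hU hx hG
  have hmp := (measurePreserving_rightMul p hO).comp (measurePreserving_leftMul q hR)
  have hm : MeasurableSet (Prod.mk G ⁻¹' (det ∘ noiseOf ρ U x ⁻¹' B)) :=
    measurable_prodMk_left ((hdet.comp hn) hB)
  rw [← hmp.measure_preimage hm.nullMeasurableSet]
  congr 1
  ext Z
  simp [h]

/-! ### The Metropolis drift -/

/-- The relative drift of `dens ^ (-α)` in a Metropolis step with density ratio `r`. -/
noncomputable def drift (α r : ℝ) : ℝ := min 1 r * (r ^ (-α) - 1)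

lemma drift_of_one_le {α r : ℝ} (hr : 1 ≤ r) : drift α r = r ^ (-α) - 1 := by
  rw [drift, min_eq_left hr, one_mul]

lemma drift_of_le_one {α r : ℝ} (hr0 : 0 < r) (hr : r ≤ 1) : drift α r = r ^ (1 - α) - r := by
  rw [drift, min_eq_right hr, sub_eq_add_neg 1 α, Real.rpow_add hr0, Real.rpow_one]
  ring

/-- For small `r` the acceptance factor tames `r ^ (-α)`: the product is `r ^ (1 - α) ≤ 1`. This
bound supplies both integrability and domination. -/
lemma abs_drift_le_one {α r : ℝ} (hα0 : 0 < α) (hα1 : α < 1) (hr : 0 < r) :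
    |drift α r| ≤ 1 := by
  rcases le_total 1 r with h | h
  · rw [drift_of_one_le h, abs_le]
    have h1 := Real.rpow_pos_of_pos hr (-α)
    have h2 := Real.rpow_le_one_of_one_le_of_nonpos h (by linarith : -α ≤ 0)
    constructor <;> linarith
  · rw [drift_of_le_one hr h, abs_le]
    have h1 := Real.rpow_pos_of_pos hr (1 - α)
    have h2 := Real.rpow_le_one hr.le h (by linarith : 0 ≤ 1 - α)
    constructor <;> linarith

lemma drift_add_drift_inv_neg_of_one_lt {α r : ℝ} (hα0 : 0 < α) (hα1 : α < 1) (hr : 1 < r) :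
    drift α r + drift α r⁻¹ < 0 := by
  have hr0 : 0 < r := one_pos.trans hr
  rw [drift_of_one_le hr.le, drift_of_le_one (inv_pos.2 hr0) (inv_le_one_of_one_le₀ hr.le)]
  have h1 : r ^ (-α) < 1 := Real.rpow_lt_one_of_one_lt_of_neg hr (by linarith)
  have h2 : r ^ (α - 1) < 1 := Real.rpow_lt_one_of_one_lt_of_neg hr (by linarith)
  have h3 : r⁻¹ ^ (1 - α) = r ^ (α - 1) := by
    rw [Real.inv_rpow hr0.le, ← Real.rpow_neg hr0.le]
    congr 1
    ring
  have h4 : r⁻¹ = r ^ (-α) * r ^ (α - 1) := by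
    rw [← Real.rpow_add hr0, ← Real.rpow_neg_one]
    congr 1
    ring
  rw [h3, h4]
  -- The sum equals `-(1 - r ^ (-α)) * (1 - r ^ (α - 1))`.
  nlinarith [mul_pos (sub_pos.2 h1) (sub_pos.2 h2)]

lemma drift_add_drift_inv_neg {α r : ℝ} (hα0 : 0 < α) (hα1 : α < 1) (hr0 : 0 < r) (hr : r ≠ 1) :
    drift α r + drift α r⁻¹ < 0 := by
  rcases lt_or_gt_of_ne hr with h | h
  · have := drift_add_drift_inv_neg_of_one_lt hα0 hα1 ((one_lt_inv₀ hr0).2 h)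
    rwa [inv_inv, add_comm] at this
  · exact drift_add_drift_inv_neg_of_one_lt hα0 hα1 h

lemma measurable_drift (α : ℝ) : Measurable (drift α) := by
  unfold drift
  fun_prop

lemma continuousAt_drift (α : ℝ) {r : ℝ} (hr : 0 < r) : ContinuousAt (drift α) r := by
  unfold drift
  exact (continuousAt_const.min continuousAt_id).mul
    ((Real.continuousAt_rpow_const r (-α) (Or.inl hr.ne')).sub continuousAt_const)

lemma metropolis_integral {X : Type*} [MeasurableSpace X] [MeasurableSingletonClass X]
    {dens : X → ℝ} {Q : X → Measure X} {S : X} [IsProbabilityMeasure (Q S)]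
    (hdens : AEMeasurable dens (Q S)) (hS : 0 < dens S) (hpos : ∀ᵐ T ∂(Q S), 0 < dens T)
    {α : ℝ} (hα0 : 0 < α) (hα1 : α < 1) {V : X → ℝ} (hV : ∀ T, V T = dens T ^ (-α)) :
    Integrable V (metropolis dens Q S) ∧
      ((∫ T, V T ∂(metropolis dens Q S)) - V S) / V S =
        ∫ T, drift α (dens T / dens S) ∂(Q S) := by
  have hVS : 0 < V S := by rw [hV]; exact Real.rpow_pos_of_pos hS _
  have ham : AEMeasurable (acceptance dens S) (Q S) := by
    unfold acceptance
    exact aemeasurable_const.min (hdens.div_const _)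
  have ha0 : ∀ᵐ T ∂(Q S), 0 ≤ acceptance dens S T := by
    filter_upwards [hpos] with T hT
    exact le_min zero_le_one (div_pos hT hS).le
  have hai : Integrable (acceptance dens S) (Q S) := by
    refine Integrable.of_bound ham.aestronglyMeasurable 1 ?_
    filter_upwards [ha0] with T hT
    rw [Real.norm_eq_abs, abs_of_nonneg hT]
    exact min_le_left _ _
  have hdm : AEMeasurable (fun T => drift α (dens T / dens S)) (Q S) :=
    (measurable_drift α).comp_aemeasurable (hdens.div_const _)
  have hdi : Integrable (fun T => drift α (dens T / dens S)) (Q S) := by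
    refine Integrable.of_bound hdm.aestronglyMeasurable 1 ?_
    filter_upwards [hpos] with T hT
    exact abs_drift_le_one hα0 hα1 (div_pos hT hS)
  -- Acceptance times `V T` is `V S` times a sum of two bounded functions, so `V` is integrable for
  -- the accepted part even if it is unbounded.
  have hprod : (fun T => (ENNReal.ofReal (acceptance dens S T)).toReal • V T) =ᵐ[Q S]
      fun T => V S * drift α (dens T / dens S) + V S * acceptance dens S T := by
    filter_upwards [hpos, ha0] with T hT hT0
    rw [ENNReal.toReal_ofReal hT0, drift, Real.div_rpow hT.le hS.le, ← hV, ← hV, smul_eq_mul]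
    unfold acceptance
    field_simp
    ring
  have hsum : Integrable
      (fun T => V S * drift α (dens T / dens S) + V S * acceptance dens S T) (Q S) :=
    (hdi.const_mul _).add (hai.const_mul _)
  have hm : AEMeasurable (fun T => ENNReal.ofReal (acceptance dens S T)) (Q S) :=
    ham.ennreal_ofReal
  have hlt : ∀ᵐ T ∂(Q S), ENNReal.ofReal (acceptance dens S T) < ∞ :=
    ae_of_all _ fun T => ENNReal.ofReal_lt_top
  have hint1 : Integrable V
      ((Q S).withDensity (fun T => ENNReal.ofReal (acceptance dens S T))) := by
    rw [integrable_withDensity_iff_integrable_smul₀' hm hlt]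
    exact hsum.congr hprod.symm
  have hint2 : Integrable V
      ((1 - ∫⁻ T, ENNReal.ofReal (acceptance dens S T) ∂(Q S)) • Measure.dirac S) :=
    (integrable_dirac (by simp)).smul_measure (ENNReal.sub_ne_top ENNReal.one_ne_top)
  refine ⟨hint1.add_measure hint2, ?_⟩
  have hrej : (1 - ∫⁻ T, ENNReal.ofReal (acceptance dens S T) ∂(Q S)).toReal =
      1 - ∫ T, acceptance dens S T ∂(Q S) := by
    rw [← ofReal_integral_eq_lintegral_ofReal hai ha0, ← ENNReal.ofReal_one,
      ← ENNReal.ofReal_sub _ (integral_nonneg_of_ae ha0), ENNReal.toReal_ofReal]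
    rw [sub_nonneg]
    calc ∫ T, acceptance dens S T ∂(Q S) ≤ ∫ _, (1 : ℝ) ∂(Q S) :=
          integral_mono hai (integrable_const _) fun T => min_le_left _ _
      _ = 1 := by simp
  rw [metropolis, integral_add_measure hint1 hint2, integral_smul_measure, integral_dirac, hrej,
    integral_withDensity_eq_integral_toReal_smul₀ hm hlt, integral_congr_ae hprod,
    integral_add (hdi.const_mul _) (hai.const_mul _), integral_const_mul, integral_const_mul,
    smul_eq_mul]
  field_simp
  ring

/-! ### The determinant of the noise has a non-degenerate law symmetric under inversion -/

lemma detRatio_reflect {p q : ℕ} {a b : ℝ} (hab : a ^ 2 + b ^ 2 = 1)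
    (GZ : Matrix (Fin p) (Fin q) ℝ × Matrix (Fin p) (Fin q) ℝ) :
    detRatio a b (a • GZ.1 + b • GZ.2, b • GZ.1 - a • GZ.2) = (detRatio a b GZ)⁻¹ := by
  have h : a • (a • GZ.1 + b • GZ.2) + b • (b • GZ.1 - a • GZ.2) = GZ.1 := by
    ext i j
    simp only [Matrix.add_apply, Matrix.sub_apply, Matrix.smul_apply, smul_eq_mul]
    linear_combination GZ.1 i j * hab
  simp only [detRatio, h, inv_div]

/-- Given `G`, the exceptional `Z` lie on the level sets 0 and `det (Gᵀ * G)` of a Gram determinant.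
-/
lemma ae_detRatio_pos_and_ne_one {p q : ℕ} (hq : 1 ≤ q) (hpq : q ≤ p) (a : ℝ) {b : ℝ}
    (hb : b ≠ 0) : ∀ᵐ GZ ∂((stdNormal p q).prod (stdNormal p q)),
      0 < detRatio a b GZ ∧ detRatio a b GZ ≠ 1 := by
  have hm : MeasurableSet {GZ : Matrix (Fin p) (Fin q) ℝ × Matrix (Fin p) (Fin q) ℝ |
      0 < detRatio a b GZ ∧ detRatio a b GZ ≠ 1} :=
    (measurableSet_lt measurable_const (measurable_detRatio a b)).inter
      ((measurable_detRatio a b) (measurableSet_singleton 1).compl)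
  refine (Measure.ae_prod_iff_ae_ae hm).2 ?_
  filter_upwards [ae_det_transpose_mul_self_ne_zero hq hpq] with G hG
  filter_upwards [ae_det_gram_ne hq hpq (a • G) hb 0,
    ae_det_gram_ne hq hpq (a • G) hb (Gᵀ * G).det] with Z h0 h1
  exact ⟨div_pos (posDef_transpose_mul_self h0).det_pos (posDef_transpose_mul_self hG).det_pos,
    fun h => h1 ((div_eq_one_iff_eq hG).1 h)⟩

lemma integral_drift_detRatio_neg {p q : ℕ} (hq : 1 ≤ q) (hpq : q ≤ p) {a b : ℝ}
    (hab : a ^ 2 + b ^ 2 = 1) (hb : b ≠ 0) {α : ℝ} (hα0 : 0 < α) (hα1 : α < 1) {κ : ℝ}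
    (hκ : κ ≠ 0) :
    ∫ GZ, drift α (detRatio a b GZ ^ κ) ∂((stdNormal p q).prod (stdNormal p q)) < 0 := by
  set μ := (stdNormal p q).prod (stdNormal p q) with hμ
  set D : Matrix (Fin p) (Fin q) ℝ × Matrix (Fin p) (Fin q) ℝ → ℝ := detRatio a b with hD
  have hDm : Measurable D := measurable_detRatio a b
  have hmeas : Measurable fun r : ℝ => drift α (r ^ κ) :=
    (measurable_drift α).comp (measurable_id.pow_const κ)
  have hae := ae_detRatio_pos_and_ne_one hq hpq a hb
  have hi1 : Integrable (fun GZ => drift α (D GZ ^ κ)) μ := by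
    refine Integrable.of_bound (hmeas.comp hDm).aestronglyMeasurable 1 ?_
    filter_upwards [hae] with GZ h
    exact abs_drift_le_one hα0 hα1 (Real.rpow_pos_of_pos h.1 κ)
  have hi2 : Integrable (fun GZ => drift α ((D GZ)⁻¹ ^ κ)) μ := by
    refine Integrable.of_bound (hmeas.comp hDm.inv).aestronglyMeasurable 1 ?_
    filter_upwards [hae] with GZ h
    exact abs_drift_le_one hα0 hα1 (Real.rpow_pos_of_pos (inv_pos.2 h.1) κ)
  have hsymm : ∫ GZ, drift α (D GZ ^ κ) ∂μ = ∫ GZ, drift α ((D GZ)⁻¹ ^ κ) ∂μ := by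
    have hmp := measurePreserving_reflect p q hab
    conv_lhs => rw [hμ, ← hmp.map_eq]
    refine (integral_map hmp.measurable.aemeasurable
      (hmeas.comp hDm).aestronglyMeasurable).trans ?_
    simp only [hD, hμ, Function.comp_apply, detRatio_reflect hab]
  have hneg : ∀ᵐ GZ ∂μ, drift α (D GZ ^ κ) + drift α ((D GZ)⁻¹ ^ κ) < 0 := by
    filter_upwards [hae] with GZ h
    rw [Real.inv_rpow h.1.le]
    refine drift_add_drift_inv_neg hα0 hα1 (Real.rpow_pos_of_pos h.1 κ) ?_
    rw [← Real.one_rpow κ]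
    exact fun h1 => h.2 ((Real.rpow_left_inj h.1.le zero_le_one hκ).1 h1)
  -- By symmetry this is `-2` times the wanted integral; an integrand positive almost everywhere has
  -- full support, which makes the inequality strict.
  have hlt : 0 < ∫ GZ, -(drift α (D GZ ^ κ) + drift α ((D GZ)⁻¹ ^ κ)) ∂μ := by
    refine (integral_pos_iff_support_of_nonneg_ae (hneg.mono fun GZ h => (neg_pos.2 h).le)
      (hi1.add hi2).neg).2 ?_
    have : (Function.support fun GZ => -(drift α (D GZ ^ κ) + drift α ((D GZ)⁻¹ ^ κ)))
        =ᵐ[μ] Set.univ :=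
      eventuallyEq_univ.2 (hneg.mono fun GZ h => (neg_pos.2 h).ne')
    rw [measure_congr this]
    simp
  rw [integral_neg, integral_add hi1 hi2, ← hsymm] at hlt
  linarith

/-! ### Transfer to the noise law and to the kernel. -/

lemma measurable_det (q : ℕ) : Measurable (det : Matrix (Fin q) (Fin q) ℝ → ℝ) :=
  Continuous.measurable (by fun_prop)

lemma ae_posDef_mpcnNoise {p q : ℕ} (hq : 1 ≤ q) (hpq : q ≤ p) {ρ : ℝ} (hρ1 : ρ < 1)
    {U : Matrix (Fin p) (Fin p) ℝ} (hU : U.PosDef) {x : Matrix (Fin p) (Fin q) ℝ}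
    (hx : (gram U x).det ≠ 0) : ∀ᵐ e ∂(mpcnNoise ρ U x), e.PosDef := by
  have hb : Real.sqrt (1 - ρ) ≠ 0 := (Real.sqrt_pos.2 (by linarith)).ne'
  have h1 : ∀ᵐ d ∂((mpcnNoise ρ U x).map det), d ≠ 0 := by
    rw [map_det_mpcnNoise hq hpq ρ hU hx]
    refine (ae_map_iff (measurable_detRatio _ _).aemeasurable
      (measurableSet_singleton (0 : ℝ)).compl).2 ?_
    exact (ae_detRatio_pos_and_ne_one hq hpq _ hb).mono fun GZ h => h.1.ne'
  have h2 : ∀ᵐ e ∂(mpcnNoise ρ U x), e.det ≠ 0 :=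
    ae_of_ae_map (measurable_det q).aemeasurable h1
  have h3 : ∀ᵐ e ∂(mpcnNoise ρ U x), e.PosSemidef := by
    rw [mpcnNoise_eq_map, ae_map_iff (measurable_noiseOf ρ U x).aemeasurable
      (measurableSet_posSemidef q)]
    exact ae_of_all _ (posSemidef_noiseOf ρ hU x)
  filter_upwards [h2, h3] with e he0 he
  exact he.posDef_iff_det_ne_zero.2 he0

lemma integral_drift_mpcnNoise_neg {p q : ℕ} (hq : 1 ≤ q) (hpq : q ≤ p) {ρ : ℝ} (hρ0 : 0 ≤ ρ)
    (hρ1 : ρ < 1) {U : Matrix (Fin p) (Fin p) ℝ} (hU : U.PosDef)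
    {x : Matrix (Fin p) (Fin q) ℝ} (hx : (gram U x).det ≠ 0) {α : ℝ} (hα0 : 0 < α) (hα1 : α < 1) {κ : ℝ}
    (hκ : κ ≠ 0) : ∫ e, drift α (e.det ^ κ) ∂(mpcnNoise ρ U x) < 0 := by
  have hmeas : Measurable fun r : ℝ => drift α (r ^ κ) :=
    (measurable_drift α).comp (measurable_id.pow_const κ)
  have h1 : ∫ e, drift α (e.det ^ κ) ∂(mpcnNoise ρ U x) =
      ∫ d, drift α (d ^ κ) ∂((mpcnNoise ρ U x).map det) :=
    (integral_map (measurable_det q).aemeasurable hmeas.aestronglyMeasurable).symm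
  rw [h1, map_det_mpcnNoise hq hpq ρ hU hx,
    integral_map (measurable_detRatio _ _).aemeasurable hmeas.aestronglyMeasurable]
  refine integral_drift_detRatio_neg hq hpq ?_ (Real.sqrt_pos.2 (by linarith)).ne' hα0 hα1 hκ
  rw [Real.sq_sqrt hρ0, Real.sq_sqrt (by linarith)]
  ring

lemma mpcnKernel_integral {p q : ℕ} (hq : 1 ≤ q) (hpq : q ≤ p) {ρ : ℝ} (hρ1 : ρ < 1)
    {U : Matrix (Fin p) (Fin p) ℝ} (hU : U.PosDef) {x : Matrix (Fin p) (Fin q) ℝ}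
    (hx : (gram U x).det ≠ 0) {dens : Matrix (Fin q) (Fin q) ℝ → ℝ}
    (hpos : ∀ S : Matrix (Fin q) (Fin q) ℝ, S.PosDef → 0 < dens S)
    (hcont : ContinuousOn dens {S | S.PosDef}) {α : ℝ} (hα0 : 0 < α) (hα1 : α < 1)
    {V : Matrix (Fin q) (Fin q) ℝ → ℝ} (hV : ∀ S, V S = dens S ^ (-α))
    {S : Matrix (Fin q) (Fin q) ℝ} (hS : S.PosDef) :
    Integrable V (mpcnKernel ρ U x dens S) ∧
      AEStronglyMeasurable (fun e => drift α (dens (circ e S) / dens S)) (mpcnNoise ρ U x) ∧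
      ((∫ T, V T ∂(mpcnKernel ρ U x dens S)) - V S) / V S =
        ∫ e, drift α (dens (circ e S) / dens S) ∂(mpcnNoise ρ U x) := by
  have hcm : Measurable fun e => circ e S := (continuous_circ S).measurable
  have hprob : IsProbabilityMeasure (walkProposal (mpcnNoise ρ U x) S) :=
    Measure.isProbabilityMeasure_map hcm.aemeasurable
  have hae : ∀ᵐ T ∂(walkProposal (mpcnNoise ρ U x) S), T.PosDef := by
    rw [walkProposal, ae_map_iff hcm.aemeasurable (measurableSet_posDef q)]
    exact (ae_posDef_mpcnNoise hq hpq hρ1 hU hx).mono fun e he => posDef_circ he hS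
  -- `dens` is controlled only on the positive definite cone, which carries the proposal law.
  have hdens : AEMeasurable dens (walkProposal (mpcnNoise ρ U x) S) := by
    have := hcont.aemeasurable (μ := walkProposal (mpcnNoise ρ U x) S) (measurableSet_posDef q)
    have hres := Measure.restrict_eq_self_of_ae_mem (s := {T : Matrix (Fin q) (Fin q) ℝ | T.PosDef}) hae
    rwa [hres] at this
  obtain ⟨h1, h2⟩ := metropolis_integral hdens (hpos S hS)
    (hae.mono fun T hT => hpos T hT) hα0 hα1 hV
  have hm : AEMeasurable (fun T => drift α (dens T / dens S))
      (walkProposal (mpcnNoise ρ U x) S) :=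
    (measurable_drift α).comp_aemeasurable (hdens.div_const _)
  refine ⟨h1, (hm.comp_measurable hcm).aestronglyMeasurable, h2.trans ?_⟩
  exact integral_map hcm.aemeasurable hm.aestronglyMeasurable

/-- Needed for dominated convergence along this filter. -/
instance (q : ℕ) : (traceToZero q).IsCountablyGenerated := by
  unfold traceToZero
  infer_instance

end MpCN

theorem mainTheorem9 (p q : ℕ) (hq : 1 ≤ q) (hpq : q ≤ p)
    (ρ : ℝ) (hρ0 : 0 ≤ ρ) (hρ1 : ρ < 1)
    (U : Matrix (Fin p) (Fin p) ℝ) (hU : U.PosDef)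
    (x : Matrix (Fin p) (Fin q) ℝ) (hx : (MpCN.gram U x).det ≠ 0)
    (dens : Matrix (Fin q) (Fin q) ℝ → ℝ)
    (hpos : ∀ S : Matrix (Fin q) (Fin q) ℝ, S.PosDef → 0 < dens S)
    (hcont : ContinuousOn dens {S | S.PosDef})
    (ζ : ℝ) (hζ : ζ ≠ 0)
    (hlim : ∀ e : Matrix (Fin q) (Fin q) ℝ, e.PosDef →
      Tendsto (fun S => dens (MpCN.circ e S) / dens S) (MpCN.traceToZero q)
        (𝓝 (e.det ^ (ζ / 2))))
    (α : ℝ) (hα0 : 0 < α) (hα1 : α < 1)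
    (V : Matrix (Fin q) (Fin q) ℝ → ℝ) (hV : ∀ S, V S = dens S ^ (-α)) :
    (∀ S : Matrix (Fin q) (Fin q) ℝ, S.PosDef →
      Integrable V (MpCN.mpcnKernel ρ U x dens S)) ∧
    limsup (fun S => ((((∫ T, V T ∂(MpCN.mpcnKernel ρ U x dens S)) - V S) / V S : ℝ) : EReal))
      (MpCN.traceToZero q) < 0 := by
  have hker := fun (S : Matrix (Fin q) (Fin q) ℝ) (hS : S.PosDef) =>
    MpCN.mpcnKernel_integral hq hpq hρ1 hU hx hpos hcont hα0 hα1 hV hS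
  refine ⟨fun S hS => (hker S hS).1, ?_⟩
  have hmem : ∀ᶠ S in MpCN.traceToZero q, S.PosDef := mem_inf_of_right (mem_principal_self _)
  have hae := MpCN.ae_posDef_mpcnNoise hq hpq hρ1 hU hx
  have hneg := MpCN.integral_drift_mpcnNoise_neg hq hpq hρ0 hρ1 hU hx hα0 hα1
    (div_ne_zero hζ two_ne_zero)
  have htends : Tendsto
      (fun S => ∫ e, MpCN.drift α (dens (MpCN.circ e S) / dens S) ∂(MpCN.mpcnNoise ρ U x))
      (MpCN.traceToZero q)
      (𝓝 (∫ e, MpCN.drift α (e.det ^ (ζ / 2)) ∂(MpCN.mpcnNoise ρ U x))) := by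
    refine tendsto_integral_filter_of_dominated_convergence (fun _ => 1)
      (hmem.mono fun S hS => (hker S hS).2.1) ?_ (integrable_const _) ?_
    · filter_upwards [hmem] with S hS
      filter_upwards [hae] with e he
      exact MpCN.abs_drift_le_one hα0 hα1
        (div_pos (hpos _ (MpCN.posDef_circ he hS)) (hpos S hS))
    · filter_upwards [hae] with e he
      exact (MpCN.continuousAt_drift α (Real.rpow_pos_of_pos he.det_pos _)).tendsto.comp
        (hlim e he)
  -- A constant strictly between the limit and 0 eventually bounds the drift, which keeps the
  -- `EReal` limsup strictly negative.
  obtain ⟨c, hc, hc0⟩ := exists_between hneg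
  have hev : ∀ᶠ S in MpCN.traceToZero q,
      ((((∫ T, V T ∂(MpCN.mpcnKernel ρ U x dens S)) - V S) / V S : ℝ) : EReal) ≤ (c : EReal) := by
    filter_upwards [hmem, htends.eventually_lt_const hc] with S hS h
    rw [(hker S hS).2.2]
    exact_mod_cast h.le
  refine lt_of_le_of_lt (limsup_le_of_le (by isBoundedDefault) hev) ?_
  exact_mod_cast hc0
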